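/- \textbf{Setting.} An abstract state space $A$ is a finite-dimensional real vector space with a positive cone $A_+$ and a linear functional $u_A$, strictly positive on $A_+\setminus\{0\}$, such that the convex set $\Omega_A=\{\alpha\in A_+ : u_A(\alpha)=1\}$ of (normalized) states is compact. An effect is a linear functional $a$ with $0\le a\le u_A$ on $A_+$. A state $\mu\in\Omega_A$ is exposed if there is an effect $a$, called a distinguishing effect for $\mu$, such that for $\omega\in\Omega_A$ one has $a(\omega)=1$ if and only if $\omega=\mu$. $A$ is nonclassical if $\Omega_A$ is not a simplex (the convex hull of a finite affinely independent set). The minimal tensor product $A\otimes B$ has as positive cone the set of nonnegative combinations of products $\alpha\otimes\beta$ with $\alpha\in A_+$, $\beta\in B_+$, and order unit $u_A\otimes u_B$. \textbf{(1) Double decompositions.} Let $A$ be nonclassical and let $d$ be the affine dimension of $\Omega_A$. Then there are a state $\omega$ and disjoint finite sets $\{\mu^0_1,\dots,\mu^0_{N_0}\}$, $\{\mu^1_1,\dots,\mu^1_{N_1}\}$ of exposed states of $A$ with $$\omega=\sum_{i=1}^{N_0}p^0_i\mu^0_i=\sum_{j=1}^{N_1}p^1_j\mu^1_j ,$$ where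 $p^0,p^1$ are probability distributions. They can be chosen with all weights positive and $N_0+N_1\le d+2$; they can also be chosen with $N_0+N_1=d+2$ if weights equal to $0$ are allowed. \textbf{(2) Bit commitment.} Let $T$ be a class of abstract state spaces that is closed under the minimal tensor product, and let $A\in T$ be nonclassical. Then $A^{\otimes n}\in T$ for all $n\ge1$ (minimal tensor powers), and there exist data $(\omega,\mu^b_i,p^b_i)$ for $A$ as in (1), without a condition on $N_0+N_1$, with a distinguishing effect $a^b_i$ for each $\mu^b_i$. For \emph{every} such choice of data consider the following protocol with $n\ge1$ systems. To commit to $b\in\{0,1\}$, Alice draws $x=(x_1,\dots,x_n)$ from $(p^b)^{n}$ and sends $\mu^b_x=\mu^b_{x_1}\otimes\cdots\otimes\mu^b_{x_n}\in\Omega_{A^{\otimes n}}$ to Bob. To reveal, she announces $(b,x)$; Bob measures each subsystem and accepts $b$ if and only if the $k$-th subsystem yields $a^b_{x_k}$ for every $k$, i.e. he accepts with the effect $a^b_x=a^b_{x_1}\otimes\cdots\otimes a^b_{x_n}$, and otherwise he rejects. Here $\mu^b_x$ is a state and $a^b_x$ an effect of $A^{\otimes n}$, and the protocol is: \begin{itemize}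 \item \emph{perfectly sound}: if Alice is honest and commits to $b$, Bob accepts $b$ with probability $1$ (and rejects, or accepts the other bit, with probability $0$); \item \emph{perfectly hiding}: for every abstract state space $F$, every $\varphi\in\Omega_F$ and every effect $e$ on $A^{\otimes n}\otimes F$, the probability $\sum_x p^b_{x_1}\cdots p^b_{x_n}\,e(\mu^b_x\otimes\varphi)$ does not depend on $b$; \item \emph{exponentially secure against a cheating Alice}: there is $q\in[0,1)$, depending only on $A$ and the chosen data, such that for every $n\ge 1$, every abstract state space $E$ (Alice's memory), every $\sigma\in\Omega_{E\otimes A^{\otimes n}}$, and all families $(M^b_x)_x$, $b\in\{0,1\}$, of positive linear functionals on $E$ with $\sum_x M^b_x\le u_E$ (her measurement on the memory when she wants to open $b$), the probabilities $P_b=\sum_x (M^b_x\otimes a^b_x)(\sigma)$ that Bob accepts $b$ satisfy $$P_0+P_1\le 1+q^{\,n}.$$ \end{itemize} -/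

import Mathlib

open scoped TensorProduct

universe u

noncomputable section

/-- An abstract state space: a finite-dimensional real vector space `V` with a positive cone and an
order unit `unit`, strictly positive on the nonzero elements of the cone, such that the set of
normalized states (a base of the cone) is compact. Compactness refers to `moduleTopology ℝ V`, the
usual vector-space topology of the finite-dimensional space `V`. -/
structure AbstractStateSpace : Type (u + 1) where
  V : Type u
  [addCommGroup : AddCommGroup V]
  [module : Module ℝ V]
  [finite : Module.Finite ℝ V]
  cone : PointedCone ℝ V
  unit : Module.Dual ℝ V
  unit_pos : ∀ x ∈ cone, x ≠ 0 → 0 < unit x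
  isCompact_base : @IsCompact V (moduleTopology ℝ V) {x | x ∈ cone ∧ unit x = 1}

namespace AbstractStateSpace

attribute [instance] addCommGroup module finite

/-- The convex set of normalized states. -/
def Ω (A : AbstractStateSpace.{u}) : Set A.V := {x | x ∈ A.cone ∧ A.unit x = 1}

/-- Effects: linear functionals `a` with `0 ≤ a ≤ unit` in the dual ordering. -/
def IsEffect (A : AbstractStateSpace.{u}) (a : Module.Dual ℝ A.V) : Prop :=
  ∀ x ∈ A.cone, 0 ≤ a x ∧ a x ≤ A.unit x

/-- `a` is a distinguishing effect for `μ`: a measurement outcome that has probability `1` when,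
and only when, the state is `μ`. -/
def IsDistinguishing (A : AbstractStateSpace.{u}) (a : Module.Dual ℝ A.V) (μ : A.V) : Prop :=
  A.IsEffect a ∧ ∀ ω ∈ A.Ω, a ω = 1 ↔ ω = μ

/-- Exposed states: normalized states with a distinguishing effect. -/
def IsExposed (A : AbstractStateSpace.{u}) (μ : A.V) : Prop :=
  μ ∈ A.Ω ∧ ∃ a, A.IsDistinguishing a μ

/-- A system is classical if its normalized states form a simplex, i.e. the convex hull of a finite
affinely independent set; it is nonclassical otherwise. -/
def Nonclassical (A : AbstractStateSpace.{u}) : Prop :=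
  ¬ ∃ s : Finset A.V, AffineIndependent ℝ ((↑) : s → A.V) ∧ A.Ω = convexHull ℝ (s : Set A.V)

/-- The affine dimension of the set of normalized states. -/
def dim (A : AbstractStateSpace.{u}) : ℕ := Module.finrank ℝ (vectorSpan ℝ A.Ω)

/-- The product `a ⊗ b` of functionals: `(a ⊗ b) (x ⊗ y) = a x * b y`. -/
def prodFunctional {V W : Type u} [AddCommGroup V] [Module ℝ V] [AddCommGroup W] [Module ℝ W]
    (a : Module.Dual ℝ V) (b : Module.Dual ℝ W) : Module.Dual ℝ (V ⊗[ℝ] W) :=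
  TensorProduct.dualDistrib ℝ V W (a ⊗ₜ[ℝ] b)

/-- The set of product states of two systems. -/
def productStates (A B : AbstractStateSpace.{u}) : Set (A.V ⊗[ℝ] B.V) :=
  Set.image2 (fun α β => α ⊗ₜ[ℝ] β) A.Ω B.Ω

theorem prodFunctional_convexHull (A B : AbstractStateSpace.{u}) {z : A.V ⊗[ℝ] B.V}
    (hz : z ∈ convexHull ℝ (productStates A B)) : prodFunctional A.unit B.unit z = 1 := by
  have hc : Convex ℝ {z : A.V ⊗[ℝ] B.V | prodFunctional A.unit B.unit z = 1} :=
    convex_hyperplane (prodFunctional A.unit B.unit).isLinear 1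
  refine convexHull_min ?_ hc hz
  rintro _ ⟨x, hx, y, hy, rfl⟩
  simp only [Set.mem_ofPred_eq, prodFunctional, TensorProduct.dualDistrib_apply]
  rw [hx.2, hy.2, one_mul]

theorem inv_unit_smul_mem (A : AbstractStateSpace.{u}) {x : A.V} (hx : x ∈ A.cone) (h0 : x ≠ 0) :
    (A.unit x)⁻¹ • x ∈ A.Ω := by
  have h := A.unit_pos x hx h0
  refine ⟨?_, ?_⟩
  · exact A.cone.smul_mem (inv_pos.2 h).le hx
  · rw [map_smul, smul_eq_mul, inv_mul_cancel₀ h.ne']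

theorem mem_minTensor_cone (A B : AbstractStateSpace.{u}) {z : A.V ⊗[ℝ] B.V}
    (hz : z ∈ PointedCone.minTensorProduct A.cone B.cone) :
    z = 0 ∨ ∃ t : ℝ, 0 < t ∧ ∃ y ∈ convexHull ℝ (productStates A B), z = t • y := by
  refine Submodule.span_induction ?_ ?_ ?_ ?_ hz
  · rintro _ ⟨x, hx, y, hy, rfl⟩
    by_cases hx0 : x = 0
    · left; simp [hx0]
    by_cases hy0 : y = 0
    · left; simp [hy0]
    have hxp := A.unit_pos x hx hx0
    have hyp := B.unit_pos y hy hy0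
    refine Or.inr ⟨A.unit x * B.unit y, mul_pos hxp hyp,
      ((A.unit x)⁻¹ • x) ⊗ₜ[ℝ] ((B.unit y)⁻¹ • y), subset_convexHull ℝ _ ?_, ?_⟩
    · exact Set.mem_image2_of_mem (A.inv_unit_smul_mem hx hx0) (B.inv_unit_smul_mem hy hy0)
    · rw [TensorProduct.smul_tmul_smul, smul_smul]
      field_simp
      simp
  · exact Or.inl rfl
  · rintro z w - - (rfl | ⟨t, ht, y, hy, rfl⟩) hw
    · simpa using hw
    · rcases hw with (rfl | ⟨s, hs, y', hy', rfl⟩)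
      · exact Or.inr ⟨t, ht, y, hy, by simp⟩
      · refine Or.inr ⟨t + s, by positivity, (t / (t + s)) • y + (s / (t + s)) • y', ?_, ?_⟩
        · exact convex_convexHull ℝ _ hy hy' (by positivity) (by positivity)
            (by field_simp)
        · rw [smul_add, smul_smul, smul_smul]
          congr 2 <;> field_simp
  · rintro r z - (rfl | ⟨t, ht, y, hy, rfl⟩)
    · left; simp
    · rcases eq_or_ne r 0 with rfl | hr
      · left; simp
      · refine Or.inr ⟨(r : ℝ) * t, mul_pos (lt_of_le_of_ne r.2 fun h => hr (Subtype.ext h.symm)) ht, y, hy, ?_⟩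
        rw [mul_smul]; rfl

theorem minTensor_base (A B : AbstractStateSpace.{u}) :
    {z | z ∈ PointedCone.minTensorProduct A.cone B.cone ∧ prodFunctional A.unit B.unit z = 1} =
      convexHull ℝ (productStates A B) := by
  apply Set.Subset.antisymm
  · rintro z ⟨hz, h1⟩
    rcases mem_minTensor_cone A B hz with (rfl | ⟨t, ht, y, hy, rfl⟩)
    · simp at h1
    · rw [map_smul, prodFunctional_convexHull A B hy, smul_eq_mul, mul_one] at h1
      simpa [h1] using hy
  · intro z hz
    refine ⟨?_, prodFunctional_convexHull A B hz⟩
    have hc : Convex ℝ (PointedCone.minTensorProduct A.cone B.cone : Set (A.V ⊗[ℝ] B.V)) :=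
      (PointedCone.minTensorProduct A.cone B.cone).convex
    refine convexHull_min ?_ hc hz
    rintro _ ⟨x, hx, y, hy, rfl⟩
    exact PointedCone.tmul_mem_minTensorProduct hx.1 hy.1

/-- In finite dimension the convex hull of a compact set is compact. -/
theorem isCompact_convexHull_of_finite {E : Type u} [AddCommGroup E] [Module ℝ E]
    [Module.Finite ℝ E] [TopologicalSpace E] [ContinuousAdd E] [ContinuousSMul ℝ E] {K : Set E}
    (hK : IsCompact K) : IsCompact (convexHull ℝ K) := by
  classical
  rcases K.eq_empty_or_nonempty with rfl | ⟨x₀, hx₀⟩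
  · simp
  let N := Module.finrank ℝ E + 1
  let f : (Fin N → ℝ) × (Fin N → E) → E := fun q => ∑ i, q.1 i • q.2 i
  have hf : Continuous f := by
    refine continuous_finsetSum _ fun i _ => ?_
    exact ((continuous_apply i).comp continuous_fst).smul
      ((continuous_apply i).comp continuous_snd)
  have hcomp : IsCompact (stdSimplex ℝ (Fin N) ×ˢ Set.univ.pi fun _ : Fin N => K) :=
    (isCompact_stdSimplex ℝ (Fin N)).prod (isCompact_univ_pi fun _ => hK)
  convert hcomp.image hf using 1
  apply Set.Subset.antisymm
  · intro x hx
    obtain ⟨ι, hι, z, w, hz, hind, hw, hw1, hsum⟩ := eq_pos_convex_span_of_mem_convexHull hx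
    have hcard : Fintype.card ι ≤ Fintype.card (Fin N) := by
      rw [Fintype.card_fin]
      exact hind.card_le_finrank_succ.trans
        (Nat.succ_le_succ (Submodule.finrank_le _))
    obtain ⟨e⟩ := Function.Embedding.nonempty_of_card_le hcard
    have hext : ∀ (M : Type u) [AddCommMonoid M] (g : Fin N → M),
        (∀ j, j ∉ Set.range e → g j = 0) → ∑ j, g j = ∑ i, g (e i) := by
      intro M _ g hg
      exact (Fintype.sum_of_injective e e.injective (fun i => g (e i)) g hg
        (fun _ => rfl)).symm
    have hextR : ∀ (g : Fin N → ℝ),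
        (∀ j, j ∉ Set.range e → g j = 0) → ∑ j, g j = ∑ i, g (e i) := by
      intro g hg
      exact (Fintype.sum_of_injective e e.injective (fun i => g (e i)) g hg
        (fun _ => rfl)).symm
    have hout : ∀ j, j ∉ Set.range e → Function.extend e w 0 j = 0 := by
      intro j hj
      rw [Function.extend_apply' _ _ _ (by simpa using hj)]; rfl
    refine ⟨(Function.extend e w 0, Function.extend e z fun _ => x₀), ⟨⟨?_, ?_⟩, ?_⟩, ?_⟩
    · intro j
      by_cases hj : j ∈ Set.range e
      · obtain ⟨i, rfl⟩ := hj
        change 0 ≤ Function.extend e w 0 (e i)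
        rw [e.injective.extend_apply]; exact (hw i).le
      · exact (hout j hj).ge
    · rw [hextR _ hout, ← hw1]
      exact Finset.sum_congr rfl fun i _ => e.injective.extend_apply _ _ _
    · intro j _
      by_cases hj : j ∈ Set.range e
      · obtain ⟨i, rfl⟩ := hj
        change Function.extend e z (fun _ => x₀) (e i) ∈ K
        rw [e.injective.extend_apply]; exact hz ⟨i, rfl⟩
      · change Function.extend e z (fun _ => x₀) j ∈ K
        rw [Function.extend_apply' _ _ _ (by simpa using hj)]; exact hx₀
    · change ∑ j, Function.extend e w 0 j • Function.extend e z (fun _ => x₀) j = x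
      rw [hext E _ (fun j hj => by rw [hout j hj, zero_smul]), ← hsum]
      exact Finset.sum_congr rfl fun i _ => by
        rw [e.injective.extend_apply, e.injective.extend_apply]
  · rintro _ ⟨⟨w, z⟩, ⟨hw, hz⟩, rfl⟩
    exact (convex_convexHull ℝ K).sum_mem (fun i _ => hw.1 i) hw.2
      fun i _ => subset_convexHull ℝ K (hz i trivial)

/-- The minimal tensor product: states are the mixtures of product states, and the order unit is
`u ⊗ u`. -/
def minTensor (A B : AbstractStateSpace.{u}) : AbstractStateSpace.{u} where
  V := A.V ⊗[ℝ] B.V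
  cone := PointedCone.minTensorProduct A.cone B.cone
  unit := prodFunctional A.unit B.unit
  unit_pos := by
    intro z hz h0
    rcases mem_minTensor_cone A B hz with (rfl | ⟨t, ht, y, hy, rfl⟩)
    · exact absurd rfl h0
    · rw [map_smul, prodFunctional_convexHull A B hy, smul_eq_mul, mul_one]
      exact ht
  isCompact_base := by
    rw [minTensor_base]
    let : TopologicalSpace A.V := moduleTopology ℝ A.V
    let : TopologicalSpace B.V := moduleTopology ℝ B.V
    let : TopologicalSpace (A.V ⊗[ℝ] B.V) := moduleTopology ℝ (A.V ⊗[ℝ] B.V)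
    have : IsModuleTopology ℝ A.V := ⟨rfl⟩
    have : IsModuleTopology ℝ B.V := ⟨rfl⟩
    have : IsModuleTopology ℝ (A.V ⊗[ℝ] B.V) := ⟨rfl⟩
    have : ContinuousAdd (A.V ⊗[ℝ] B.V) := IsModuleTopology.toContinuousAdd ℝ _
    apply isCompact_convexHull_of_finite
    have hc : Continuous fun q : A.V × B.V => TensorProduct.mk ℝ A.V B.V q.1 q.2 :=
      IsModuleTopology.continuous_bilinear_of_finite_left (TensorProduct.mk ℝ A.V B.V)
    have h := (A.isCompact_base.prod B.isCompact_base).image hc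
    rw [Set.image_prod (f := fun x y => TensorProduct.mk ℝ A.V B.V x y)] at h
    exact h

/-- `A.power n` is the minimal tensor product of `n + 1` copies of `A`. -/
def power (A : AbstractStateSpace.{u}) : ℕ → AbstractStateSpace.{u}
  | 0 => A
  | n + 1 => (A.power n).minTensor A

/-- The product `x 0 ⊗ ⋯ ⊗ x n` in `A.power n`. -/
def prodState (A : AbstractStateSpace.{u}) : (n : ℕ) → (Fin (n + 1) → A.V) → (A.power n).V
  | 0, x => x 0
  | n + 1, x =>
    (A.prodState n (fun k => x k.castSucc) ⊗ₜ[ℝ] x (Fin.last (n + 1)) : (A.power n).V ⊗[ℝ] A.V)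

/-- The product `a 0 ⊗ ⋯ ⊗ a n` of functionals, as a functional on `A.power n`. -/
def prodEffect (A : AbstractStateSpace.{u}) :
    (n : ℕ) → (Fin (n + 1) → Module.Dual ℝ A.V) → Module.Dual ℝ (A.power n).V
  | 0, a => a 0
  | n + 1, a => prodFunctional (A.prodEffect n fun k => a k.castSucc) (a (Fin.last (n + 1)))

/-- A class of systems that is closed under the minimal tensor product. -/
def ClosedUnderMinTensor (T : Set AbstractStateSpace.{u}) : Prop :=
  ∀ A ∈ T, ∀ B ∈ T, A.minTensor B ∈ T

/-- A state `ω` of `A` with two decompositions, labelled by a bit `b`, into disjoint finite sets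
`{state b i | i}` of exposed states with probability weights `weight b i`. -/
structure DoubleDecomposition (A : AbstractStateSpace.{u}) where
  ω : A.V
  /-- the number of states in each decomposition -/
  N : Bool → ℕ
  state : (b : Bool) → Fin (N b) → A.V
  weight : (b : Bool) → Fin (N b) → ℝ
  exposed : ∀ b i, A.IsExposed (state b i)
  injective : ∀ b, Function.Injective (state b)
  disjoint : ∀ i j, state false i ≠ state true j
  weight_nonneg : ∀ b i, 0 ≤ weight b i
  weight_sum : ∀ b, ∑ i, weight b i = 1
  decomposition : ∀ b, ∑ i, weight b i • state b i = ω

/-- The public data of the bit commitment protocol: a double decomposition together with a choice of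
a distinguishing effect for each of its exposed states. -/
structure Scheme (A : AbstractStateSpace.{u}) extends DoubleDecomposition A where
  effect : (b : Bool) → Fin (N b) → Module.Dual ℝ A.V
  distinguishing : ∀ b i, A.IsDistinguishing (effect b i) (state b i)

namespace Scheme

variable {A : AbstractStateSpace.{u}}

/-- The strings that can accompany the bit `b` in the protocol with `n + 1` systems. -/
abbrev Str (P : A.Scheme) (n : ℕ) (b : Bool) : Type := Fin (n + 1) → Fin (P.N b)

/-- The probability with which the honest Alice, committing to `b`, draws the string `x`. -/
def prob (P : A.Scheme) (n : ℕ) (b : Bool) (x : P.Str n b) : ℝ := ∏ k, P.weight b (x k)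

/-- The state that the honest Alice sends in the commit phase. -/
def commitState (P : A.Scheme) (n : ℕ) (b : Bool) (x : P.Str n b) : (A.power n).V :=
  A.prodState n fun k => P.state b (x k)

/-- The effect by which Bob accepts the opening `(b, x)`: the `k`-th subsystem yields the
distinguishing effect of `state b (x k)`, for every `k`. -/
def accept (P : A.Scheme) (n : ℕ) (b : Bool) (x : P.Str n b) : Module.Dual ℝ (A.power n).V :=
  A.prodEffect n fun k => P.effect b (x k)

/-- The distribution of Bob's verdict when he holds the state `ρ` and the opening `(b, x)` is
announced: `some b'` means that he accepts the bit `b'`, `none` that he rejects. -/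
def verdict (P : A.Scheme) (n : ℕ) (ρ : (A.power n).V) (b : Bool) (x : P.Str n b) :
    Option Bool → ℝ
  | none => (A.power n).unit ρ - P.accept n b x ρ
  | some b' => if b' = b then P.accept n b x ρ else 0

/-- The protocol is physically meaningful: honest commitments are normalized states, and Bob's
acceptance is an effect. -/
def WellDefined (P : A.Scheme) (n : ℕ) : Prop :=
  ∀ b (x : P.Str n b),
    P.commitState n b x ∈ (A.power n).Ω ∧ (A.power n).IsEffect (P.accept n b x)

/-- Perfect soundness: if Alice is honest and commits to `b`, then, with probability `1`, Bob
accepts and obtains the bit `b`. -/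
def PerfectlySound (P : A.Scheme) (n : ℕ) : Prop :=
  ∀ b o, ∑ x : P.Str n b, P.prob n b x * P.verdict n (P.commitState n b x) b x o =
    if o = some b then 1 else 0

/-- Perfect hiding: before the reveal phase no effect on the systems received from the honest Alice
together with an ancilla of Bob (any system `F` in any state `φ`) has a probability that depends on
the committed bit. -/
def PerfectlyHiding (P : A.Scheme) (n : ℕ) : Prop :=
  ∀ (F : AbstractStateSpace.{u}), ∀ φ ∈ F.Ω, ∀ e : Module.Dual ℝ ((A.power n).V ⊗[ℝ] F.V),
    ((A.power n).minTensor F).IsEffect e →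
      ∑ x : P.Str n false, P.prob n false x * e (P.commitState n false x ⊗ₜ[ℝ] φ) =
        ∑ x : P.Str n true, P.prob n true x * e (P.commitState n true x ⊗ₜ[ℝ] φ)

/-- A strategy of a cheating Alice: she prepares a joint (unentangled) state of a memory, which is
an arbitrary system, and the `n + 1` systems that she sends to Bob. Later, when she wants to open the
bit `b`, she measures the memory and announces the outcome as the string; the measurement may have
a further outcome in which she gives up, so that its effects sum to at most the order unit. -/
structure Cheat (P : A.Scheme) (n : ℕ) where
  memory : AbstractStateSpace.{u}
  joint : memory.V ⊗[ℝ] (A.power n).V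
  joint_mem : joint ∈ (memory.minTensor (A.power n)).Ω
  measure : (b : Bool) → P.Str n b → Module.Dual ℝ memory.V
  measure_nonneg : ∀ b x, ∀ m ∈ memory.cone, 0 ≤ measure b x m
  measure_sum : ∀ b, ∀ m ∈ memory.cone, ∑ x, measure b x m ≤ memory.unit m

/-- The probability that a cheating Alice who wants to open `b` makes Bob accept `b`. -/
def Cheat.success {P : A.Scheme} {n : ℕ} (S : P.Cheat n) (b : Bool) : ℝ :=
  ∑ x, prodFunctional (S.measure b x) (P.accept n b x) S.joint

/-- Exponential security against Alice: for a rate `q < 1` independent of the number of systems and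
of her strategy, the probabilities with which she can open `0` and `1` satisfy
`p₀ + p₁ ≤ 1 + q ^ (number of systems)`. -/
def ExponentiallyBinding (P : A.Scheme) : Prop :=
  ∃ q : ℝ, 0 ≤ q ∧ q < 1 ∧ ∀ (n : ℕ) (S : P.Cheat n),
    S.success false + S.success true ≤ 1 + q ^ (n + 1)

end Scheme

end AbstractStateSpace

end

/-! ### Exposed points of compact convex sets. -/

noncomputable section

/-! Double decompositions come from any nontrivial affine relation between exposed states: move the
negative coefficients to the other side and normalize. Such a relation exists as soon as there are
`dim + 2` exposed states. If there are finitely many, their hull is closed, so by Straszewicz it is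
all of `Ω`; nonclassicality then makes them affinely dependent, hence at least `dim + 2` in number.

Hiding is multilinearity: for either bit the averaged commitment is the tensor power of `ω`. For
binding, effects distinguishing two different states are never both certain, so by compactness and
finiteness the product of their probabilities is at most some `q < 1` on `Ω`. On a product state of
`N` systems the acceptance probabilities `s`, `t` of two openings satisfy `s * t ≤ q ^ N`, while `(1
- s) * (1 - t) ≥ 0` gives `s + t ≤ 1 + s * t`. Joint states in the minimal tensor product are
mixtures of products, and on a product the memory only randomizes the announced string; so the bound
extends to every cheat by linearity. -/

/-- **Straszewicz**, in separated form: a compact set that is not contained in a closed convex set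
`C` has an exposed point outside `C`. -/
theorem exists_strict_max_notMem_of_isCompact {H : Type*} [NormedAddCommGroup H]
    [InnerProductSpace ℝ H] [CompleteSpace H] {K C : Set H} (hK : IsCompact K)
    (hC : Convex ℝ C) (hCc : IsClosed C) {z : H} (hz : z ∈ K) (hzC : z ∉ C) :
    ∃ y ∈ K, y ∉ C ∧ ∃ f : H →ₗ[ℝ] ℝ, ∀ w ∈ K, w ≠ y → f w < f y := by
  obtain ⟨g, c, hg, hgz⟩ := geometric_hahn_banach_closed_point hC hCc hzC
  set v := (InnerProductSpace.toDual ℝ H).symm g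
  have hv : ∀ w, inner ℝ v w = g w := fun w => InnerProductSpace.toDual_symm_apply
  obtain ⟨M, hM⟩ := hK.exists_bound_of_continuousOn (f := fun w => ‖w - z‖ ^ 2)
    (by fun_prop)
  have hM' : ∀ w ∈ K, ‖w - z‖ ^ 2 ≤ M := fun w hw => (le_abs_self _).trans (hM w hw)
  have hM0 : 0 ≤ M := by simpa using hM' z hz
  have hgap : 0 < g z - c := sub_pos.2 hgz
  -- The center `x` lies far behind `z` as seen from `C`. For `w ∈ K ∩ C`, passing from `z` to `w`
  -- changes the squared distance to `x` by at most `M - 2 * t * (g z - c) = -1`, so a farthest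
  -- point of `K` from `x` avoids `C`.
  set t : ℝ := (M + 1) / (2 * (g z - c)) with ht
  have htpos : 0 < t := by positivity
  set x := z - t • v with hx
  obtain ⟨y, hy, hmax⟩ := hK.exists_isMaxOn ⟨z, hz⟩ (f := fun w => ‖w - x‖) (by fun_prop)
  have hmax' : ∀ w ∈ K, ‖w - x‖ ≤ ‖y - x‖ := fun w hw => hmax hw
  refine ⟨y, hy, fun hyC => ?_, (innerSL ℝ (y - x)).toLinearMap, fun w hw hne => ?_⟩
  · have h1 : ‖z - x‖ ^ 2 ≤ ‖y - x‖ ^ 2 := by gcongr; exact hmax' z hz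
    have e1 : z - x = t • v := by rw [hx]; abel
    have e2 : y - x = (y - z) + t • v := by rw [hx]; abel
    rw [e1, e2, norm_add_sq_real, inner_smul_right, real_inner_comm, hv, map_sub] at h1
    have h2 := hM' y hy
    have h3 := hg y hyC
    have h4 : t * (2 * (g z - c)) = M + 1 := by rw [ht]; field_simp
    nlinarith
  -- `K` lies in the ball around `x` through `y`, and the tangent hyperplane at `y` meets that ball
  -- only in `y`.
  · change inner ℝ (y - x) w < inner ℝ (y - x) y
    have h1 : ‖w - x‖ ^ 2 ≤ ‖y - x‖ ^ 2 := by gcongr; exact hmax' w hw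
    have h2 : 0 < ‖w - y‖ ^ 2 := by
      have := norm_pos_iff.2 (sub_ne_zero.2 hne)
      positivity
    have e : w - y = (w - x) - (y - x) := by abel
    rw [e, norm_sub_sq_real] at h2
    have h3 : inner ℝ (w - x) (y - x) = inner ℝ (y - x) w - inner ℝ (y - x) x := by
      rw [real_inner_comm, inner_sub_right]
    have h4 : inner ℝ (y - x) y - inner ℝ (y - x) x = ‖y - x‖ ^ 2 := by
      rw [← inner_sub_right, real_inner_self_eq_norm_sq]
    linarith

/-! ### States, effects and exposed states. -/

namespace AbstractStateSpace

variable {A B : AbstractStateSpace.{u}}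

theorem exists_unit_smul_eq {x : A.V} (hx : x ∈ A.cone) :
    x = 0 ∨ 0 < A.unit x ∧ ∃ y ∈ A.Ω, x = A.unit x • y := by
  by_cases h0 : x = 0
  · exact Or.inl h0
  · have h := A.unit_pos x hx h0
    exact Or.inr ⟨h, _, A.inv_unit_smul_mem hx h0, by rw [smul_inv_smul₀ h.ne']⟩

theorem unit_nonneg {x : A.V} (hx : x ∈ A.cone) : 0 ≤ A.unit x := by
  rcases exists_unit_smul_eq hx with rfl | ⟨h, -⟩
  · simp
  · exact h.le

theorem nonneg_of_nonneg_states {f : Module.Dual ℝ A.V} (h : ∀ x ∈ A.Ω, 0 ≤ f x) {x : A.V}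
    (hx : x ∈ A.cone) : 0 ≤ f x := by
  rcases exists_unit_smul_eq hx with rfl | ⟨hu, y, hy, hxy⟩
  · simp
  · rw [hxy, map_smul]
    exact mul_nonneg hu.le (h y hy)

theorem isEffect_of_states {f : Module.Dual ℝ A.V} (h : ∀ x ∈ A.Ω, 0 ≤ f x ∧ f x ≤ 1) :
    A.IsEffect f := fun x hx => by
  refine ⟨nonneg_of_nonneg_states (fun y hy => (h y hy).1) hx, sub_nonneg.1 ?_⟩
  refine nonneg_of_nonneg_states (f := A.unit - f) (fun y hy => ?_) hx
  rw [LinearMap.sub_apply, hy.2]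
  exact sub_nonneg.2 (h y hy).2

theorem IsEffect.le_one {f : Module.Dual ℝ A.V} (h : A.IsEffect f) {x : A.V} (hx : x ∈ A.Ω) :
    f x ≤ 1 := hx.2 ▸ (h x hx.1).2

theorem convex_Ω (A : AbstractStateSpace.{u}) : Convex ℝ A.Ω :=
  A.cone.convex.inter (convex_hyperplane A.unit.isLinear 1)

/-- One compactness statement with two uses: with `g` the unit it gives extrema of a linear
functional on states, and with two effects it gives the worst case for binding. -/
theorem exists_max_mul_of_Ω_nonempty (h : A.Ω.Nonempty) {f g : Module.Dual ℝ A.V} :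
    ∃ x ∈ A.Ω, ∀ y ∈ A.Ω, f y * g y ≤ f x * g x := by
  let : TopologicalSpace A.V := moduleTopology ℝ A.V
  have : IsModuleTopology ℝ A.V := ⟨rfl⟩
  have hK : IsCompact A.Ω := A.isCompact_base
  have hf : Continuous f := IsModuleTopology.continuous_of_linearMap f
  have hg : Continuous g := IsModuleTopology.continuous_of_linearMap g
  exact hK.exists_isMaxOn h (hf.mul hg).continuousOn

/-- An affine rescaling by means of the unit turns `f` into an effect with value `1` exactly at its
maximizer. -/
theorem isExposed_of_strict_max {μ : A.V} (hμ : μ ∈ A.Ω) (f : Module.Dual ℝ A.V)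
    (hf : ∀ w ∈ A.Ω, w ≠ μ → f w < f μ) : A.IsExposed μ := by
  obtain ⟨x, hx, hmin⟩ := exists_max_mul_of_Ω_nonempty ⟨μ, hμ⟩ (f := -f) (g := A.unit)
  have hmin' : ∀ w ∈ A.Ω, f x ≤ f w := fun w hw => by
    simpa [hw.2, hx.2] using hmin w hw
  -- Subtracting `1` from the minimum keeps the denominator `f μ - m` positive even when `Ω` is a
  -- single point.
  set m := f x - 1 with hm
  have hpos : 0 < f μ - m := by linarith [hmin' μ hμ]
  have hval : ∀ w ∈ A.Ω, ((f μ - m)⁻¹ • (f - m • A.unit)) w = (f w - m) / (f μ - m) := by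
    intro w hw
    simp [hw.2, div_eq_inv_mul]
  have hle : ∀ w ∈ A.Ω, f w ≤ f μ := fun w hw => by
    by_cases h : w = μ
    · rw [h]
    · exact (hf w hw h).le
  refine ⟨hμ, (f μ - m)⁻¹ • (f - m • A.unit), isEffect_of_states fun w hw => ?_,
    fun w hw => ?_⟩
  · rw [hval w hw]
    exact ⟨div_nonneg (by linarith [hmin' w hw]) hpos.le,
      (div_le_one hpos).2 (by linarith [hle w hw])⟩
  · rw [hval w hw, div_eq_one_iff_eq hpos.ne']
    refine ⟨fun h => ?_, fun h => by rw [h]⟩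
    by_contra hne
    linarith [hf w hw hne]

/-- Finiteness makes the hull compact, hence closed, so a state outside it would yield a further
exposed state. A linear isomorphism with Euclidean space supplies the inner product for the
farthest-point argument. -/
theorem convexHull_exposed_eq_Ω_of_finite (h : {μ | A.IsExposed μ}.Finite) :
    convexHull ℝ {μ | A.IsExposed μ} = A.Ω := by
  refine Set.Subset.antisymm (convexHull_min (fun μ hμ => hμ.1) A.convex_Ω) fun z hz => ?_
  by_contra hzC
  let e : A.V ≃ₗ[ℝ] EuclideanSpace ℝ (Fin (Module.finrank ℝ A.V)) :=
    LinearEquiv.ofFinrankEq _ _ (by simp)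
  have hK : IsCompact (e '' A.Ω) := by
    let : TopologicalSpace A.V := moduleTopology ℝ A.V
    have : IsModuleTopology ℝ A.V := ⟨rfl⟩
    exact IsCompact.image A.isCompact_base
      (IsModuleTopology.continuous_of_linearMap e.toLinearMap)
  have himg : e '' convexHull ℝ {μ | A.IsExposed μ} = convexHull ℝ (e '' {μ | A.IsExposed μ}) :=
    e.toLinearMap.image_convexHull _
  obtain ⟨_, ⟨μ, hμ, rfl⟩, hμC, f, hf⟩ := exists_strict_max_notMem_of_isCompact hK
    (C := e '' convexHull ℝ {μ | A.IsExposed μ}) (by rw [himg]; exact convex_convexHull ℝ _)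
    (by rw [himg]; exact ((h.image e).isCompact_convexHull ℝ).isClosed)
    (Set.mem_image_of_mem e hz) (by rwa [e.injective.mem_set_image])
  refine hμC (Set.mem_image_of_mem e (subset_convexHull ℝ _ ?_))
  exact isExposed_of_strict_max hμ (f ∘ₗ e.toLinearMap) fun w hw hne =>
    hf _ (Set.mem_image_of_mem e hw) (e.injective.ne hne)

/-! ### Affine relations and double decompositions. -/

theorem Nonclassical.exists_exposed_finset (hA : A.Nonclassical) :
    ∃ t : Finset A.V, (∀ μ ∈ t, A.IsExposed μ) ∧ t.card = A.dim + 2 := by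
  by_cases h : {μ | A.IsExposed μ}.Finite
  · have hcoe : (h.toFinset : Set A.V) = {μ | A.IsExposed μ} := h.coe_toFinset
    have hconv := convexHull_exposed_eq_Ω_of_finite h
    have hdep : ¬ AffineIndependent ℝ ((↑) : h.toFinset → A.V) := fun hi =>
      hA ⟨h.toFinset, hi, by rw [hcoe, hconv]⟩
    have hspan : vectorSpan ℝ (Set.range ((↑) : h.toFinset → A.V)) = vectorSpan ℝ A.Ω := by
      have hr : Set.range ((↑) : h.toFinset → A.V) = {μ | A.IsExposed μ} :=
        Subtype.range_coe.trans hcoe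
      rw [hr, ← direction_affineSpan, ← direction_affineSpan, ← hconv, affineSpan_convexHull]
    have hcard : A.dim + 2 ≤ h.toFinset.card := by
      -- The rank criterion concerns `n + 1` points; the empty family is separately excluded because
      -- it is affinely independent.
      rcases hn : h.toFinset.card with _ | n
      · have : IsEmpty h.toFinset := by
          rw [← Fintype.card_eq_zero_iff, Fintype.card_coe, hn]
        exact absurd (affineIndependent_of_subsingleton ℝ _) hdep
      · rw [affineIndependent_iff_le_finrank_vectorSpan ℝ _ (n := n)
          (by rw [Fintype.card_coe, hn]), hspan] at hdep
        have : A.dim < n := not_le.1 hdep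
        omega
    obtain ⟨t, ht, htc⟩ := Finset.exists_subset_card_eq hcard
    exact ⟨t, fun μ hμ => by simpa using ht hμ, htc⟩
  · obtain ⟨t, ht, htc⟩ := Set.Infinite.exists_subset_card_eq h (A.dim + 2)
    exact ⟨t, fun μ hμ => ht hμ, htc⟩

theorem exists_nontrivial_relation_of_card {t : Finset A.V} (ht : ∀ μ ∈ t, μ ∈ A.Ω)
    (hc : t.card = A.dim + 2) :
    ∃ c : A.V → ℝ, ∑ μ ∈ t, c μ • μ = 0 ∧ ∑ μ ∈ t, c μ = 0 ∧ ∃ μ ∈ t, c μ ≠ 0 := by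
  apply exists_nontrivial_relation_sum_zero_of_not_affine_ind
  rw [← finrank_vectorSpan_le_iff_not_affineIndependent ℝ _ (n := A.dim)
    (by rw [Fintype.card_coe, hc])]
  refine Submodule.finrank_mono (vectorSpan_mono ℝ ?_)
  rintro _ ⟨μ, rfl⟩
  exact ht μ μ.2

/-- Two disjoint finite sets of exposed states with weights that give the same mixture. -/
def DoubleDecomposition.ofFinset (s : Bool → Finset A.V) (w : Bool → A.V → ℝ) (ω : A.V)
    (hexp : ∀ b, ∀ μ ∈ s b, A.IsExposed μ) (hdisj : Disjoint (s false) (s true))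
    (hw : ∀ b, ∀ μ ∈ s b, 0 ≤ w b μ) (hsum : ∀ b, ∑ μ ∈ s b, w b μ = 1)
    (hdec : ∀ b, ∑ μ ∈ s b, w b μ • μ = ω) : A.DoubleDecomposition where
  ω := ω
  N b := (s b).card
  state b i := (s b).equivFin.symm i
  weight b i := w b ((s b).equivFin.symm i)
  exposed b i := hexp b _ (Subtype.coe_prop _)
  injective b := Subtype.coe_injective.comp (s b).equivFin.symm.injective
  disjoint i j := Finset.disjoint_iff_ne.1 hdisj _ (Subtype.coe_prop _) _ (Subtype.coe_prop _)
  weight_nonneg b i := hw b _ (Subtype.coe_prop _)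
  weight_sum b := by
    rw [(s b).equivFin.symm.sum_comp (fun μ : s b => w b μ), Finset.sum_coe_sort (s b) (w b),
      hsum b]
  decomposition b := by
    rw [(s b).equivFin.symm.sum_comp (fun μ : s b => w b μ • (μ : A.V)),
      Finset.sum_coe_sort (s b) (fun μ => w b μ • μ), hdec b]

/-- An affine relation between exposed states, split into the states with positive coefficients and
the rest, is a double decomposition. -/
theorem exists_doubleDecomposition_of_relation {t : Finset A.V} (ht : ∀ μ ∈ t, A.IsExposed μ)
    {c : A.V → ℝ} (hv : ∑ μ ∈ t, c μ • μ = 0) (hc : ∑ μ ∈ t, c μ = 0)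
    (hne : ∃ μ ∈ t, c μ ≠ 0) :
    ∃ D : A.DoubleDecomposition, D.N false + D.N true = t.card ∧
      ((∀ μ ∈ t, c μ ≠ 0) → ∀ b i, 0 < D.weight b i) := by
  classical
  -- States with coefficient zero go to the `true` side, where they get weight zero.
  set s : Bool → Finset A.V := fun b =>
    bif b then t.filter (fun μ => ¬ 0 < c μ) else t.filter (fun μ => 0 < c μ) with hs
  set S := ∑ μ ∈ t.filter (fun μ => 0 < c μ), c μ with hS
  have hsub : ∀ b, s b ⊆ t := by rintro (_ | _) <;> exact Finset.filter_subset _ _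
  have hSpos : 0 < S := by
    obtain ⟨μ, hμ, hcμ⟩ := Finset.exists_pos_of_sum_zero_of_exists_nonzero c hc hne
    exact Finset.sum_pos (fun ν hν => (Finset.mem_filter.1 hν).2)
      ⟨μ, Finset.mem_filter.2 ⟨hμ, hcμ⟩⟩
  -- As the coefficients sum to zero, the nonpositive ones sum to `-S`, so `S` normalizes both
  -- sides.
  have hsplit := Finset.sum_filter_add_sum_filter_not t (fun μ => 0 < c μ) c
  have hsplitv := Finset.sum_filter_add_sum_filter_not t (fun μ => 0 < c μ) (fun μ => c μ • μ)
  rw [hc] at hsplit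
  rw [hv] at hsplitv
  refine ⟨DoubleDecomposition.ofFinset s (fun b μ => S⁻¹ * bif b then -c μ else c μ)
    (S⁻¹ • ∑ μ ∈ t.filter (fun μ => 0 < c μ), c μ • μ) (fun b μ hμ => ht μ (hsub b hμ))
    (Finset.disjoint_filter_filter_not t t _) ?_ ?_ ?_, ?_, ?_⟩
  · rintro (_ | _) μ hμ
    · exact mul_nonneg (inv_pos.2 hSpos).le (Finset.mem_filter.1 hμ).2.le
    · refine mul_nonneg (inv_pos.2 hSpos).le ?_
      simpa using (Finset.mem_filter.1 hμ).2
  · rintro (_ | _)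
    · simp only [hs, cond_false, ← Finset.mul_sum]
      exact inv_mul_cancel₀ hSpos.ne'
    · simp only [hs, cond_true, ← Finset.mul_sum, Finset.sum_neg_distrib]
      rw [← eq_neg_of_add_eq_zero_left hsplit]
      exact inv_mul_cancel₀ hSpos.ne'
  · rintro (_ | _)
    · simp only [hs, cond_false, mul_smul, ← Finset.smul_sum]
    · simp only [hs, cond_true, mul_smul, ← Finset.smul_sum, neg_smul, Finset.sum_neg_distrib]
      rw [← eq_neg_of_add_eq_zero_left hsplitv]
  · exact Finset.card_filter_add_card_filter_not (fun μ => 0 < c μ)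
  · rintro hnz (_ | _) i
    · have h := (Finset.mem_filter.1 ((s false).equivFin.symm i).2).2
      exact mul_pos (inv_pos.2 hSpos) h
    · have h := Finset.mem_filter.1 ((s true).equivFin.symm i).2
      refine mul_pos (inv_pos.2 hSpos) (neg_pos.2 ?_)
      exact lt_of_le_of_ne (not_lt.1 h.2) (hnz _ h.1)

/-- Discarding the zero coefficients before splitting gives positive weights; keeping them gives
exactly `dim + 2` states. -/
theorem Nonclassical.exists_doubleDecomposition (hA : A.Nonclassical) :
    (∃ D : A.DoubleDecomposition, D.N false + D.N true ≤ A.dim + 2 ∧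
      ∀ b i, 0 < D.weight b i) ∧
    (∃ D : A.DoubleDecomposition, D.N false + D.N true = A.dim + 2) := by
  classical
  obtain ⟨t, ht, htc⟩ := hA.exists_exposed_finset
  obtain ⟨c, hv, hc, hne⟩ := exists_nontrivial_relation_of_card (fun μ hμ => (ht μ hμ).1) htc
  constructor
  · obtain ⟨D, hD, hpos⟩ := exists_doubleDecomposition_of_relation
      (t := t.filter fun μ => c μ ≠ 0) (c := c) (fun μ hμ => ht μ (Finset.mem_filter.1 hμ).1)
      ((Finset.sum_filter_of_ne fun μ _ h => left_ne_zero_of_smul h).trans hv)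
      (by rw [Finset.sum_filter_ne_zero, hc])
      (by
        obtain ⟨μ, hμ, h⟩ := hne
        exact ⟨μ, Finset.mem_filter.2 ⟨hμ, h⟩, h⟩)
    exact ⟨D, by rw [hD, ← htc]; exact Finset.card_filter_le _ _,
      hpos fun μ hμ => (Finset.mem_filter.1 hμ).2⟩
  · obtain ⟨D, hD, -⟩ := exists_doubleDecomposition_of_relation ht hv hc hne
    exact ⟨D, hD.trans htc⟩

/-! ### Product states and effects on minimal tensor powers. -/

theorem prodFunctional_tmul {V W : Type u} [AddCommGroup V] [Module ℝ V] [AddCommGroup W]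
    [Module ℝ W] (a : Module.Dual ℝ V) (b : Module.Dual ℝ W) (x : V) (y : W) :
    prodFunctional a b (x ⊗ₜ[ℝ] y) = a x * b y := by
  simp [prodFunctional, TensorProduct.dualDistrib_apply]

/-- The minimal cone is generated by product vectors. This is where the absence of entanglement
enters. -/
theorem nonneg_of_nonneg_tmul {f : Module.Dual ℝ (A.V ⊗[ℝ] B.V)}
    (h : ∀ x ∈ A.cone, ∀ y ∈ B.cone, 0 ≤ f (x ⊗ₜ y)) {z : A.V ⊗[ℝ] B.V}
    (hz : z ∈ (A.minTensor B).cone) : 0 ≤ f z := by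
  refine Submodule.span_induction (p := fun z _ => 0 ≤ f z) ?_ ?_ ?_ ?_ hz
  · rintro _ ⟨x, hx, y, hy, rfl⟩
    exact h x hx y hy
  · rw [map_zero]
  · intro x y _ _ hx hy
    rw [map_add]
    exact add_nonneg hx hy
  · intro r x _ hx
    have : f (r • x) = (r : ℝ) * f x := f.map_smul (r : ℝ) x
    rw [this]
    exact mul_nonneg r.2 hx

theorem tmul_mem_Ω {x : A.V} {y : B.V} (hx : x ∈ A.Ω) (hy : y ∈ B.Ω) :
    x ⊗ₜ[ℝ] y ∈ (A.minTensor B).Ω :=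
  ⟨PointedCone.tmul_mem_minTensorProduct hx.1 hy.1,
    (prodFunctional_tmul _ _ _ _).trans (by rw [hx.2, hy.2, one_mul])⟩

theorem IsEffect.prodFunctional {a : Module.Dual ℝ A.V} {b : Module.Dual ℝ B.V}
    (ha : A.IsEffect a) (hb : B.IsEffect b) :
    (A.minTensor B).IsEffect (prodFunctional a b) := fun z hz => by
  refine ⟨nonneg_of_nonneg_tmul (fun x hx y hy => ?_) hz, sub_nonneg.1 ?_⟩
  · rw [prodFunctional_tmul]
    exact mul_nonneg (ha x hx).1 (hb y hy).1
  · refine nonneg_of_nonneg_tmul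
      (f := AbstractStateSpace.prodFunctional A.unit B.unit -
        AbstractStateSpace.prodFunctional a b) (fun x hx y hy => ?_) hz
    rw [LinearMap.sub_apply, prodFunctional_tmul, prodFunctional_tmul, sub_nonneg]
    exact mul_le_mul (ha x hx).2 (hb y hy).2 (hb y hy).1 (unit_nonneg hx)

theorem prodState_mem_Ω : ∀ (n : ℕ) {x : Fin (n + 1) → A.V}, (∀ k, x k ∈ A.Ω) →
    A.prodState n x ∈ (A.power n).Ω
  | 0, _, hx => hx 0
  | n + 1, _, hx => tmul_mem_Ω (prodState_mem_Ω n fun k => hx k.castSucc) (hx _)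

theorem isEffect_prodEffect : ∀ (n : ℕ) {a : Fin (n + 1) → Module.Dual ℝ A.V},
    (∀ k, A.IsEffect (a k)) → (A.power n).IsEffect (A.prodEffect n a)
  | 0, _, ha => ha 0
  | n + 1, _, ha => (isEffect_prodEffect n fun k => ha k.castSucc).prodFunctional (ha _)

theorem prodEffect_prodState : ∀ (n : ℕ) (a : Fin (n + 1) → Module.Dual ℝ A.V)
    (x : Fin (n + 1) → A.V), A.prodEffect n a (A.prodState n x) = ∏ k, a k (x k)
  | 0, a, x => (Fin.prod_univ_one fun k => a k (x k)).symm
  | n + 1, a, x => by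
    rw [Fin.prod_univ_castSucc, ← prodEffect_prodState n]
    exact prodFunctional_tmul _ _ _ _

/-- A functional that is nonnegative on product states is nonnegative on the cone of the minimal
tensor power. -/
theorem nonneg_of_nonneg_prodState : ∀ (n : ℕ) {f : Module.Dual ℝ (A.power n).V},
    (∀ x : Fin (n + 1) → A.V, (∀ k, x k ∈ A.Ω) → 0 ≤ f (A.prodState n x)) →
    ∀ {z : (A.power n).V}, z ∈ (A.power n).cone → 0 ≤ f z
  | 0, f, h, z, hz => nonneg_of_nonneg_states (A := A) (f := f)
      (fun x hx => h (fun _ => x) fun _ => hx) hz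
  | n + 1, f, h, z, hz => by
    refine nonneg_of_nonneg_tmul (A := A.power n) (B := A) (f := f) (fun x hx y hy => ?_) hz
    -- Currying: first the last factor is reduced to a state, then induction treats the remaining
    -- factors with that state fixed.
    refine nonneg_of_nonneg_states (A := A)
      (f := f ∘ₗ TensorProduct.mk ℝ (A.power n).V A.V x) (fun y hy => ?_) hy
    refine nonneg_of_nonneg_prodState n
      (f := f ∘ₗ (TensorProduct.mk ℝ (A.power n).V A.V).flip y) (fun x hx => ?_) hx
    have := h (Fin.snoc x y) (fun k => by
      refine Fin.lastCases ?_ (fun k => ?_) k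
      · simpa using hy
      · simpa using hx k)
    simp only [prodState, Fin.snoc_castSucc, Fin.snoc_last] at this
    exact this

/-- Expanding the product by multilinearity: independent draws average to the product of the
averages. -/
theorem sum_prod_smul_prodState {ι : Type} [Fintype ι] (w : ι → ℝ) (s : ι → A.V) : ∀ n : ℕ,
    ∑ x : Fin (n + 1) → ι, (∏ k, w (x k)) • A.prodState n (fun k => s (x k)) =
      A.prodState n fun _ => ∑ i, w i • s i
  | 0 => by
    rw [← (Equiv.funUnique (Fin 1) ι).symm.sum_comp]
    simp [prodState]
    rfl
  | n + 1 => by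
    rw [← (Fin.snocEquiv fun _ => ι).sum_comp, Fintype.sum_prod_type, Finset.sum_comm]
    have key : ∀ (x : Fin (n + 1) → ι) (i : ι),
        (∏ k, w (Fin.snocEquiv (fun _ => ι) (i, x) k)) •
          A.prodState (n + 1) (fun k => s (Fin.snocEquiv (fun _ => ι) (i, x) k)) =
        (((∏ k, w (x k)) • A.prodState n fun k => s (x k)) ⊗ₜ[ℝ] (w i • s i) :
          (A.power n).V ⊗[ℝ] A.V) := fun x i => by
      rw [TensorProduct.smul_tmul_smul, Fin.prod_univ_castSucc]
      simp [prodState, Fin.snocEquiv]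
      rfl
    simp_rw [key]
    change _ = (A.prodState n (fun _ => ∑ i, w i • s i) ⊗ₜ[ℝ] (∑ i, w i • s i) :
          (A.power n).V ⊗[ℝ] A.V)
    rw [← sum_prod_smul_prodState w s n, TensorProduct.sum_tmul]
    simp_rw [TensorProduct.tmul_sum]
    rfl

theorem power_mem {T : Set AbstractStateSpace.{u}} (hT : ClosedUnderMinTensor T) (hA : A ∈ T) :
    ∀ n, A.power n ∈ T
  | 0 => hA
  | n + 1 => hT _ (power_mem hT hA n) _ hA

theorem Nonclassical.nonempty_scheme (hA : A.Nonclassical) : Nonempty A.Scheme := by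
  obtain ⟨⟨D, -⟩, -⟩ := hA.exists_doubleDecomposition
  choose e he using fun b i => (D.exposed b i).2
  exact ⟨{ D with effect := e, distinguishing := he }⟩

/-! ### Soundness and hiding. -/

namespace Scheme

theorem wellDefined (P : A.Scheme) (n : ℕ) : P.WellDefined n := fun b x =>
  ⟨prodState_mem_Ω n fun k => (P.exposed b (x k)).1,
    isEffect_prodEffect n fun k => (P.distinguishing b (x k)).1⟩

theorem effect_state (P : A.Scheme) (b : Bool) (i : Fin (P.N b)) :
    P.effect b i (P.state b i) = 1 :=
  ((P.distinguishing b i).2 _ (P.exposed b i).1).2 rfl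

theorem accept_commitState (P : A.Scheme) (n : ℕ) (b : Bool) (x : P.Str n b) :
    P.accept n b x (P.commitState n b x) = 1 := by
  rw [accept, commitState, prodEffect_prodState]
  exact Finset.prod_eq_one fun k _ => P.effect_state b (x k)

theorem sum_prob (P : A.Scheme) (n : ℕ) (b : Bool) : ∑ x : P.Str n b, P.prob n b x = 1 := by
  have := Finset.sum_prod_piFinset (Finset.univ : Finset (Fin (P.N b)))
    (fun _ : Fin (n + 1) => P.weight b)
  simpa [prob, P.weight_sum] using this

theorem perfectlySound (P : A.Scheme) (n : ℕ) : P.PerfectlySound n := by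
  intro b o
  have hv : ∀ x, P.verdict n (P.commitState n b x) b x o = if o = some b then 1 else 0 := by
    intro x
    rcases o with _ | b'
    · simp [verdict, accept_commitState, (P.wellDefined n b x).1.2]
    · simp [verdict, accept_commitState]
  simp_rw [hv, ← Finset.sum_mul, P.sum_prob, one_mul]

/-- Both sides equal the value of `e` on the tensor power of `ω` together with `φ`. -/
theorem perfectlyHiding (P : A.Scheme) (n : ℕ) : P.PerfectlyHiding n := by
  intro F φ _ e _
  have key : ∀ b, ∑ x : P.Str n b, P.prob n b x * e (P.commitState n b x ⊗ₜ[ℝ] φ) =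
      e ((A.prodState n fun _ => P.ω) ⊗ₜ[ℝ] φ) := by
    intro b
    rw [← P.decomposition b, ← sum_prod_smul_prodState, TensorProduct.sum_tmul, map_sum]
    refine Finset.sum_congr rfl fun x _ => ?_
    rw [← TensorProduct.smul_tmul', map_smul, smul_eq_mul, prob, commitState]
  rw [key, key]

/-! ### Security against a cheating Alice. -/

theorem Ω_nonempty (P : A.Scheme) : A.Ω.Nonempty := by
  rcases h : P.N false with _ | n
  · have := P.weight_sum false
    have : IsEmpty (Fin (P.N false)) := by rw [h]; infer_instance
    simp_all
  · exact ⟨_, (P.exposed false ⟨0, by omega⟩).1⟩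

theorem effect_mem_Icc (P : A.Scheme) (b : Bool) (i : Fin (P.N b)) {α : A.V} (hα : α ∈ A.Ω) :
    0 ≤ P.effect b i α ∧ P.effect b i α ≤ 1 :=
  ⟨((P.distinguishing b i).1 α hα.1).1, (P.distinguishing b i).1.le_one hα⟩

/-- Two numbers in the unit interval with product `1` are both `1`, which would identify `α` with a
state of each decomposition, against disjointness. -/
theorem effect_mul_effect_lt_one (P : A.Scheme) (i : Fin (P.N false)) (j : Fin (P.N true))
    {α : A.V} (hα : α ∈ A.Ω) : P.effect false i α * P.effect true j α < 1 := by
  have hi := P.effect_mem_Icc false i hα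
  have hj := P.effect_mem_Icc true j hα
  by_contra! h
  have h1 : P.effect false i α = 1 := by nlinarith
  have h2 : P.effect true j α = 1 := by nlinarith
  exact P.disjoint i j ((((P.distinguishing false i).2 α hα).1 h1).symm.trans
    (((P.distinguishing true j).2 α hα).1 h2))

/-- No state is nearly certain to be accepted as states of both decompositions. -/
theorem exists_effect_mul_effect_le (P : A.Scheme) : ∃ q : ℝ, 0 ≤ q ∧ q < 1 ∧
    ∀ i j, ∀ α ∈ A.Ω, P.effect false i α * P.effect true j α ≤ q := by
  choose m hm hmax using fun p : Fin (P.N false) × Fin (P.N true) =>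
    exists_max_mul_of_Ω_nonempty P.Ω_nonempty (f := P.effect false p.1) (g := P.effect true p.2)
  -- Inserting `0` makes the maximum exist and be nonnegative.
  let S : Finset ℝ := insert 0
    (Finset.univ.image fun p => P.effect false p.1 (m p) * P.effect true p.2 (m p))
  have hS : S.Nonempty := ⟨0, Finset.mem_insert_self _ _⟩
  refine ⟨S.max' hS, S.le_max' _ (Finset.mem_insert_self _ _), ?_, fun i j α hα => ?_⟩
  · rw [Finset.max'_lt_iff]
    intro r hr
    rcases Finset.mem_insert.1 hr with rfl | hr
    · exact one_pos
    · obtain ⟨p, -, rfl⟩ := Finset.mem_image.1 hr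
      exact P.effect_mul_effect_lt_one _ _ (hm p)
  · refine (hmax (i, j) α hα).trans (S.le_max' _ (Finset.mem_insert_of_mem ?_))
    exact Finset.mem_image_of_mem _ (Finset.mem_univ _)

theorem accept_add_accept_le (P : A.Scheme) {q : ℝ}
    (hq : ∀ i j, ∀ α ∈ A.Ω, P.effect false i α * P.effect true j α ≤ q) (n : ℕ)
    {α : Fin (n + 1) → A.V} (hα : ∀ k, α k ∈ A.Ω) (x : P.Str n false) (y : P.Str n true) :
    P.accept n false x (A.prodState n α) + P.accept n true y (A.prodState n α) ≤
      1 + q ^ (n + 1) := by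
  rw [accept, accept, prodEffect_prodState, prodEffect_prodState]
  have hs : ∏ k, P.effect false (x k) (α k) ≤ 1 := Finset.prod_le_one
    (fun k _ => (P.effect_mem_Icc _ _ (hα k)).1) fun k _ => (P.effect_mem_Icc _ _ (hα k)).2
  have ht : ∏ k, P.effect true (y k) (α k) ≤ 1 := Finset.prod_le_one
    (fun k _ => (P.effect_mem_Icc _ _ (hα k)).1) fun k _ => (P.effect_mem_Icc _ _ (hα k)).2
  have hst : (∏ k, P.effect false (x k) (α k)) * ∏ k, P.effect true (y k) (α k) ≤
      q ^ (n + 1) := by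
    rw [← Finset.prod_mul_distrib]
    calc _ ≤ ∏ _k : Fin (n + 1), q := Finset.prod_le_prod
          (fun k _ => mul_nonneg (P.effect_mem_Icc _ _ (hα k)).1 (P.effect_mem_Icc _ _ (hα k)).1)
          fun k _ => hq _ _ _ (hα k)
      _ = q ^ (n + 1) := by simp
  -- This is `s + t ≤ 1 + s * t`, from `(1 - s) * (1 - t) ≥ 0`.
  nlinarith [mul_nonneg (sub_nonneg.2 hs) (sub_nonneg.2 ht)]

instance (P : A.Scheme) (b : Bool) : Nonempty (Fin (P.N b)) := by
  rw [← not_isEmpty_iff]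
  intro h
  simpa using P.weight_sum b

/-- On a product of memory and Bob's systems the announced string carries no information about Bob's
part, so always announcing the most acceptable string is optimal. -/
theorem exists_sum_measure_le (P : A.Scheme) {n : ℕ} (S : P.Cheat n) (b : Bool)
    {m : S.memory.V} (hm : m ∈ S.memory.cone) {s : (A.power n).V} (hs : s ∈ (A.power n).cone) :
    ∃ x, ∑ y, S.measure b y m * P.accept n b y s ≤ S.memory.unit m * P.accept n b x s := by
  obtain ⟨x, hx⟩ := Finite.exists_max fun y => P.accept n b y s
  refine ⟨x, ?_⟩
  calc _ ≤ ∑ y, S.measure b y m * P.accept n b x s := Finset.sum_le_sum fun y _ =>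
        mul_le_mul_of_nonneg_left (hx y) (S.measure_nonneg b y m hm)
    _ = (∑ y, S.measure b y m) * P.accept n b x s := by rw [Finset.sum_mul]
    _ ≤ _ := mul_le_mul_of_nonneg_right (S.measure_sum b m hm)
        ((P.wellDefined n b x).2 s hs).1

theorem exponentiallyBinding (P : A.Scheme) : P.ExponentiallyBinding := by
  obtain ⟨q, hq0, hq1, hq⟩ := P.exists_effect_mul_effect_le
  refine ⟨q, hq0, hq1, fun n S => ?_⟩
  set f : Bool → Module.Dual ℝ (S.memory.V ⊗[ℝ] (A.power n).V) := fun b =>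
    ∑ x, prodFunctional (S.measure b x) (P.accept n b x) with hf
  have hsucc : ∀ b, S.success b = f b S.joint := fun b => by
    simp [Cheat.success, hf, LinearMap.sum_apply]
  have hfm : ∀ b m s, f b (m ⊗ₜ s) = ∑ x, S.measure b x m * P.accept n b x s := fun b m s => by
    simp [hf, LinearMap.sum_apply, prodFunctional_tmul]
  have hunit : prodFunctional S.memory.unit (A.power n).unit S.joint = 1 := S.joint_mem.2
  -- The bound is written as nonnegativity of one linear functional, which need only be tested on
  -- memory vectors tensored with product states.
  have key : 0 ≤ ((1 + q ^ (n + 1)) • prodFunctional S.memory.unit (A.power n).unit -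
      (f false + f true)) S.joint := by
    refine nonneg_of_nonneg_tmul (fun m hm s hs => ?_) S.joint_mem.1
    refine nonneg_of_nonneg_prodState n (f := ((1 + q ^ (n + 1)) •
      prodFunctional S.memory.unit (A.power n).unit - (f false + f true)) ∘ₗ
        TensorProduct.mk ℝ S.memory.V (A.power n).V m) (fun α hα => ?_) hs
    have hΩ := prodState_mem_Ω n hα
    obtain ⟨x, hx⟩ := P.exists_sum_measure_le S false hm hΩ.1
    obtain ⟨y, hy⟩ := P.exists_sum_measure_le S true hm hΩ.1
    have hxy := mul_le_mul_of_nonneg_left (P.accept_add_accept_le hq n hα x y)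
      (unit_nonneg hm)
    simp only [LinearMap.comp_apply, TensorProduct.mk_apply, LinearMap.sub_apply,
      LinearMap.smul_apply, LinearMap.add_apply, hfm, prodFunctional_tmul, hΩ.2, smul_eq_mul]
    linarith
  rw [LinearMap.sub_apply, LinearMap.smul_apply, LinearMap.add_apply, hunit, smul_eq_mul,
    mul_one, ← hsucc, ← hsucc] at key
  linarith

end Scheme

end AbstractStateSpace

end

theorem mainTheorem7 :
    (∀ A : AbstractStateSpace.{u}, A.Nonclassical →
      (∃ D : A.DoubleDecomposition, D.N false + D.N true ≤ A.dim + 2 ∧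
        ∀ b i, 0 < D.weight b i) ∧
      (∃ D : A.DoubleDecomposition, D.N false + D.N true = A.dim + 2)) ∧
    (∀ T : Set AbstractStateSpace.{u}, AbstractStateSpace.ClosedUnderMinTensor T →
      ∀ A ∈ T, A.Nonclassical →
        (∀ n, A.power n ∈ T) ∧ Nonempty A.Scheme ∧
        ∀ P : A.Scheme,
          (∀ n, P.WellDefined n ∧ P.PerfectlySound n ∧ P.PerfectlyHiding n) ∧
          P.ExponentiallyBinding) :=
  ⟨fun _ hA => hA.exists_doubleDecomposition, fun _ hT _ hAT hA =>
    ⟨AbstractStateSpace.power_mem hT hAT, hA.nonempty_scheme, fun P =>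
      ⟨fun n => ⟨P.wellDefined n, P.perfectlySound n, P.perfectlyHiding n⟩,
        P.exponentiallyBinding⟩⟩⟩
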